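/- Let $B_{c_0}$ be the open unit ball of the complex Banach space $c_0$ and identify $c_0^{**}$ with $\ell_\infty$. Let $\mathcal H^\infty(B_{c_0})$ be the algebra of bounded holomorphic functions $f\colon B_{c_0}\to\mathbb C$ and $\mathcal A_u(B_{c_0})$ its subalgebra of uniformly continuous functions, both with the supremum norm. For $\mathcal A$ either algebra let $\mathcal M(\mathcal A)$ be the set of nonzero homomorphisms $\mathcal A\to\mathbb C$, put $$\rho_{\mathcal A}(\varphi,\psi)=\sup\{|\varphi(f)| : f\in\mathcal A,\ \|f\|\le 1,\ \psi(f)=0\},$$ and let the Gleason part of $\varphi\in\mathcal M(\mathcal A)$ be $\mathcal{GP}_{\mathcal A}(\varphi)=\{\psi\in\mathcal M(\mathcal A) : \rho_{\mathcal A}(\varphi,\psi)<1\}$; these sets are the classes of the equivalence relation $\rho_{\mathcal A}(\varphi,\psi)<1$. For $z\in\ell_\infty$ with $\|z\|\le 1$ let $\mathcal M_z(\mathcal H^\infty(B_{c_0}))$ be the set of those $\varphi\in\mathcal M(\mathcal H^\infty(B_{c_0}))$ whose restriction to $c_0^*\subset\mathcal H^\infty(B_{c_0})$ is $z$, and let $\delta_z\in\mathcal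 M(\mathcal A_u(B_{c_0}))$ be $\delta_z(f)=\tilde f(z)$, where $\tilde f$ is the canonical (Aron--Berner) extension of $f$ to the open unit ball of $\ell_\infty$, extended by continuity to the closed ball. Let $z,w\in\ell_\infty$ with $\|z\|=\|w\|=1$ be such that $\delta_z$ and $\delta_w$ lie in the same Gleason part for $\mathcal A_u(B_{c_0})$, that is, $\rho_{\mathcal A_u(B_{c_0})}(\delta_z,\delta_w)<1$. Then there exist $\varphi\in\mathcal M_z(\mathcal H^\infty(B_{c_0}))$ and $\psi\in\mathcal M_w(\mathcal H^\infty(B_{c_0}))$ such that $\mathcal{GP}_{\mathcal H^\infty(B_{c_0})}(\varphi)=\mathcal{GP}_{\mathcal H^\infty(B_{c_0})}(\psi)$. -/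

import Mathlib

open scoped BoundedContinuousFunction ZeroAtInfty ENNReal

noncomputable section

namespace GleasonParts

section General

/-- A function on the open unit ball of `X`, extended by `0` to all of `X`. -/
def extendZero {X : Type*} [NormedAddCommGroup X] (f : Metric.ball (0 : X) 1 → ℂ) : X → ℂ :=
  Function.extend Subtype.val f 0

theorem extendZero_coe {X : Type*} [NormedAddCommGroup X] (f : Metric.ball (0 : X) 1 → ℂ) (x : Metric.ball (0 : X) 1) :
    extendZero f x = f x :=
  Subtype.val_injective.extend_apply f 0 x

theorem uniformContinuous_mul {X : Type*} [NormedAddCommGroup X] {f g : Metric.ball (0 : X) 1 →ᵇ ℂ}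
    (hf : UniformContinuous f) (hg : UniformContinuous g) : UniformContinuous (f * g) := by
  rw [Metric.uniformContinuous_iff] at *
  intro ε hε
  have hC : 0 < ‖f‖ + ‖g‖ + 1 := by positivity
  obtain ⟨a, ha, hfa⟩ := hf (ε / (‖f‖ + ‖g‖ + 1)) (by positivity)
  obtain ⟨b, hb, hgb⟩ := hg (ε / (‖f‖ + ‖g‖ + 1)) (by positivity)
  refine ⟨min a b, lt_min ha hb, fun {x y} hxy => ?_⟩
  have h1 := hfa (hxy.trans_le (min_le_left _ _))
  have h2 := hgb (hxy.trans_le (min_le_right _ _))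
  rw [dist_eq_norm] at h1 h2 ⊢
  have e : (f * g) x - (f * g) y = f x * (g x - g y) + (f x - f y) * g y := by
    simp only [BoundedContinuousFunction.coe_mul, Pi.mul_apply]; ring
  have hd : 0 < ε / (‖f‖ + ‖g‖ + 1) := by positivity
  calc ‖(f * g) x - (f * g) y‖ ≤ ‖f x‖ * ‖g x - g y‖ + ‖f x - f y‖ * ‖g y‖ := by
        rw [e]; exact (norm_add_le _ _).trans (by simp)
    _ ≤ ‖f‖ * (ε / (‖f‖ + ‖g‖ + 1)) + (ε / (‖f‖ + ‖g‖ + 1)) * ‖g‖ := by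
        gcongr
        · exact f.norm_coe_le_norm x
        · exact g.norm_coe_le_norm y
    _ < (‖f‖ + ‖g‖ + 1) * (ε / (‖f‖ + ‖g‖ + 1)) := by nlinarith
    _ = ε := by field_simp

variable {X : Type*} [NormedAddCommGroup X] [NormedSpace ℂ X]

/-- `f : B_X → ℂ` is holomorphic: complex Fréchet differentiable at every point of the open
unit ball. -/
def IsHolomorphic (f : Metric.ball (0 : X) 1 → ℂ) : Prop :=
  DifferentiableOn ℂ (extendZero f) (Metric.ball 0 1)

theorem isHolomorphic_of_eq {f : Metric.ball (0 : X) 1 → ℂ} {F : X → ℂ}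
    (hF : DifferentiableOn ℂ F (Metric.ball 0 1)) (h : ∀ x, f x = F x) : IsHolomorphic f :=
  hF.congr fun x hx => (extendZero_coe f ⟨x, hx⟩).trans (h ⟨x, hx⟩)

variable (X) in
/-- `H^∞(B_X)`: the bounded holomorphic functions on the open unit ball of `X`, with the
supremum norm inherited from the bounded continuous functions. -/
def HInf : Subalgebra ℂ (Metric.ball (0 : X) 1 →ᵇ ℂ) where
  carrier := {f | IsHolomorphic f}
  mul_mem' {f g} hf hg := isHolomorphic_of_eq (DifferentiableOn.mul hf hg) fun x => by
    simp [extendZero_coe]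
  add_mem' {f g} hf hg := isHolomorphic_of_eq (DifferentiableOn.add hf hg) fun x => by
    simp [extendZero_coe]
  algebraMap_mem' c := isHolomorphic_of_eq (F := fun _ => c) (differentiableOn_const c) fun x => by
    simp

variable (X) in
/-- `A_u(B_X)`: the uniformly continuous holomorphic functions on the open unit ball of `X`
(these are automatically bounded), with the supremum norm. -/
def Au : Subalgebra ℂ (Metric.ball (0 : X) 1 →ᵇ ℂ) where
  carrier := {f | f ∈ HInf X ∧ UniformContinuous f}
  mul_mem' hf hg := ⟨mul_mem hf.1 hg.1, uniformContinuous_mul hf.2 hg.2⟩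
  add_mem' hf hg := ⟨add_mem hf.1 hg.1, UniformContinuous.add hf.2 hg.2⟩
  algebraMap_mem' c := ⟨algebraMap_mem _ c, uniformContinuous_const⟩

/-- The spectrum `M(A)`: the nonzero (continuous) multiplicative linear functionals on `A`. -/
abbrev Spectrum (A : Subalgebra ℂ (Metric.ball (0 : X) 1 →ᵇ ℂ)) : Type _ :=
  WeakDual.characterSpace ℂ A

/-- The pseudo-hyperbolic distance
`ρ(φ, ψ) = sup {|φ(f)| : f ∈ A, ‖f‖ ≤ 1, ψ(f) = 0}`, as a supremum in `[0, ∞]`. -/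
def pseudoHyperbolic {A : Subalgebra ℂ (Metric.ball (0 : X) 1 →ᵇ ℂ)} (φ ψ : A → ℂ) : ℝ≥0∞ :=
  ⨆ (f : A) (_ : ‖f‖ ≤ 1) (_ : ψ f = 0), ‖φ f‖ₑ

/-- The Gleason part `GP(φ) = {ψ ∈ M(A) : ρ(φ, ψ) < 1}`. -/
def gleasonPart {A : Subalgebra ℂ (Metric.ball (0 : X) 1 →ᵇ ℂ)} (φ : Spectrum A) :
    Set (Spectrum A) :=
  {ψ | pseudoHyperbolic φ ψ < 1}

/-- The restriction to the open unit ball of a continuous linear functional. -/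
def restrictDual (φ : StrongDual ℂ X) : Metric.ball (0 : X) 1 →ᵇ ℂ :=
  BoundedContinuousFunction.ofNormedAddCommGroup (fun x => φ x)
    (φ.continuous.comp continuous_subtype_val) ‖φ‖ fun x =>
      φ.unit_le_opNorm x (mem_ball_zero_iff.1 x.2).le

theorem restrictDual_mem_HInf (φ : StrongDual ℂ X) : restrictDual φ ∈ HInf X :=
  isHolomorphic_of_eq φ.differentiable.differentiableOn fun _ => rfl

/-- The fiber `M_z(H^∞(B_X))` over `z ∈ X**`: the characters of `H^∞(B_X)` whose restriction
to `X* ⊆ H^∞(B_X)` is `z`. -/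
def fiber (z : StrongDual ℂ (StrongDual ℂ X)) : Set (Spectrum (HInf X)) :=
  {χ | ∀ φ : StrongDual ℂ X, χ ⟨restrictDual φ, restrictDual_mem_HInf φ⟩ = z φ}

/-- The canonical (Arens, Aron-Berner) extension to the bidual of continuous `k`-linear forms,
evaluated at the diagonal point `(z, …, z)`:
`A ↦ z (x₁ ↦ z (x₂ ↦ ⋯ z (x_k ↦ A (x₁, …, x_k))))`. -/
def aronBerner (z : StrongDual ℂ (StrongDual ℂ X)) :
    (k : ℕ) → StrongDual ℂ (X [×k]→L[ℂ] ℂ)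
  | 0 => (continuousMultilinearCurryFin0 ℂ X ℂ : (X [×0]→L[ℂ] ℂ) →L[ℂ] ℂ)
  | k + 1 =>
    (z.comp (ContinuousLinearMap.compL ℂ X (X [×k]→L[ℂ] ℂ) ℂ (aronBerner z k))).comp
      (continuousMultilinearCurryLeftEquiv ℂ (fun _ : Fin (k + 1) => X) ℂ :
        (X [×(k + 1)]→L[ℂ] ℂ) →L[ℂ] (X →L[ℂ] (X [×k]→L[ℂ] ℂ)))

/-- The canonical extension `f̃` of a holomorphic `f : B_X → ℂ` to the open unit ball of `X**`:
the homogeneous Taylor polynomials of `f` at `0` are extended to `X**` and summed. -/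
def canonicalExtension (f : Metric.ball (0 : X) 1 → ℂ) (z : StrongDual ℂ (StrongDual ℂ X)) : ℂ :=
  ∑' k : ℕ, ((k.factorial : ℂ))⁻¹ * aronBerner z k (iteratedFDeriv ℂ k (extendZero f) 0)

/-- The evaluation `δ_z` on `A_u(B_X)` at a point `z` of the closed unit ball of `X**`:
`δ_z(f)` is the value at `z` of the continuous extension of `f̃` from the open to the closed
unit ball of `X**`. -/
def evalAu (z : StrongDual ℂ (StrongDual ℂ X)) (f : Au X) : ℂ :=
  extendFrom (Metric.ball 0 1) (canonicalExtension (f : Metric.ball (0 : X) 1 →ᵇ ℂ)) z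

end General

/-- The unit vector `e_n` of `c₀`. -/
def unitVec (n : ℕ) : C₀(ℕ, ℂ) where
  toFun := (Pi.single n 1 : ℕ → ℂ)
  continuous_toFun := continuous_of_discreteTopology
  zero_at_infty' := by
    rw [Filter.cocompact_eq_cofinite]
    refine tendsto_const_nhds.congr' ?_
    filter_upwards [(Set.finite_singleton n).compl_mem_cofinite] with m hm
    have hmn : m ≠ n := by simpa using hm
    simp [hmn]

theorem sum_norm_apply_unitVec_le (φ : StrongDual ℂ C₀(ℕ, ℂ)) (s : Finset ℕ) :
    ∑ n ∈ s, ‖φ (unitVec n)‖ ≤ ‖φ‖ := by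
  choose c hc using fun n => Complex.exists_norm_eq_mul_self (φ (unitVec n))
  set x : C₀(ℕ, ℂ) := ∑ n ∈ s, c n • unitVec n with hx
  have hx1 : ‖x‖ ≤ 1 := by
    rw [← ZeroAtInftyContinuousMap.norm_toBCF_eq_norm]
    refine (BoundedContinuousFunction.norm_le zero_le_one).2 fun m => ?_
    have hm : x m = if m ∈ s then c m else 0 := by
      have h0 : x m = ∑ n ∈ s, c n * (Pi.single n (1 : ℂ) : ℕ → ℂ) m := by
        have : ∀ t : Finset ℕ, (∑ n ∈ t, c n • unitVec n : C₀(ℕ, ℂ)) m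
            = ∑ n ∈ t, c n * (Pi.single n (1 : ℂ) : ℕ → ℂ) m := by
          intro t
          induction t using Finset.induction_on with
          | empty => simp
          | insert a t ha ih =>
            rw [Finset.sum_insert ha, Finset.sum_insert ha, ← ih]; rfl
        exact this s
      rw [h0]
      simp [Pi.single_apply]
    change ‖x m‖ ≤ 1
    rw [hm]
    split_ifs
    · exact (hc m).1.le
    · simp
  have h : φ x = ((∑ n ∈ s, ‖φ (unitVec n)‖ : ℝ) : ℂ) := by
    rw [hx, map_sum, Complex.ofReal_sum]
    exact Finset.sum_congr rfl fun n _ => by rw [map_smul, smul_eq_mul, (hc n).2]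
  calc ∑ n ∈ s, ‖φ (unitVec n)‖ = ‖φ x‖ := by
        rw [h, Complex.norm_real, Real.norm_of_nonneg (Finset.sum_nonneg fun _ _ => norm_nonneg _)]
    _ ≤ ‖φ‖ := φ.unit_le_opNorm x hx1

theorem summable_norm_apply_unitVec (φ : StrongDual ℂ C₀(ℕ, ℂ)) :
    Summable fun n => ‖φ (unitVec n)‖ :=
  summable_of_sum_le (fun _ => norm_nonneg _) (sum_norm_apply_unitVec_le φ)

theorem norm_apply_unitVec_mul_le (φ : StrongDual ℂ C₀(ℕ, ℂ)) (z : lp (fun _ : ℕ => ℂ) ∞) (n : ℕ) :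
    ‖φ (unitVec n) * z n‖ ≤ ‖φ (unitVec n)‖ * ‖z‖ := by
  rw [norm_mul]
  gcongr
  exact lp.norm_apply_le_norm ENNReal.top_ne_zero z n

theorem summable_apply_unitVec_mul (φ : StrongDual ℂ C₀(ℕ, ℂ)) (z : lp (fun _ : ℕ => ℂ) ∞) :
    Summable fun n => φ (unitVec n) * z n :=
  .of_norm_bounded ((summable_norm_apply_unitVec φ).mul_right ‖z‖) (norm_apply_unitVec_mul_le φ z)

/-- The canonical identification of `ℓ_∞` with the bidual of `c₀`: the sequence `z` acts on
`φ ∈ c₀* = ℓ₁` as `∑ φ(e_n) z_n`. -/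
def toBidual (z : lp (fun _ : ℕ => ℂ) ∞) : StrongDual ℂ (StrongDual ℂ C₀(ℕ, ℂ)) :=
  LinearMap.mkContinuous
    { toFun := fun φ : StrongDual ℂ C₀(ℕ, ℂ) => ∑' n, φ (unitVec n) * z n
      map_add' := fun φ ψ => by
        rw [← (summable_apply_unitVec_mul φ z).tsum_add (summable_apply_unitVec_mul ψ z)]
        exact tsum_congr fun n => add_mul _ _ _
      map_smul' := fun c φ => by
        rw [RingHom.id_apply, smul_eq_mul, ← tsum_mul_left]
        exact tsum_congr fun n => mul_assoc _ _ _ }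
    ‖z‖ fun φ => by
      refine (tsum_of_norm_bounded
        ((summable_norm_apply_unitVec φ).mul_right ‖z‖).hasSum (norm_apply_unitVec_mul_le φ z)).trans ?_
      rw [tsum_mul_right, mul_comm]
      gcongr
      exact Real.tsum_le_of_sum_le (fun _ => norm_nonneg _) (sum_norm_apply_unitVec_le φ)

end GleasonParts

end

/-! Testing the hypothesis on one-variable functions of a coordinate gives `r < 1` such that, for
every `n`, `z n` and `w n` are at pseudo-hyperbolic distance at most `r`
(`norm_apply_sub_apply_le`); the multiplied-out form `‖a - b‖ ≤ r * ‖1 - conj b * a‖` also makes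
sense on the unit circle, where it forces `a = b`.

Scaling and truncating both sequences gives points of the ball of `c₀` that converge weak-star to
`z` and `w` and keep the same coordinatewise bound. An analytic disc through each pair of
approximants then shows that every `f` in the unit ball of `H^∞` takes values at distance at most
`r` on them (`schwarz_pick_truncation`). Limits of the point evaluations along one common
ultrafilter are characters in the two fibers (`exists_spectrum_tendsto`) that satisfy the same
estimate, and this makes their Gleason parts equal (`gleasonPart_eq`). -/

noncomputable section

namespace GleasonParts

open scoped ComplexConjugate Topology

open Filter Metric

/-! ### Pseudo-hyperbolic estimates in the unit disc -/

section PseudoHyperbolicDisc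

theorem norm_one_sub_conj_mul_sq_sub (a b : ℂ) :
    ‖1 - conj b * a‖ ^ 2 - ‖a - b‖ ^ 2 = (1 - ‖a‖ ^ 2) * (1 - ‖b‖ ^ 2) := by
  simp only [Complex.sq_norm, Complex.normSq_apply, Complex.sub_re, Complex.sub_im,
    Complex.mul_re, Complex.mul_im, Complex.conj_re, Complex.conj_im, Complex.one_re,
    Complex.one_im]
  ring

theorem norm_sub_le_norm_one_sub_conj_mul {a b : ℂ} (ha : ‖a‖ ≤ 1) (hb : ‖b‖ ≤ 1) :
    ‖a - b‖ ≤ ‖1 - conj b * a‖ := by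
  refine le_of_sq_le_sq ?_ (norm_nonneg _)
  have h := norm_one_sub_conj_mul_sq_sub a b
  have : 0 ≤ (1 - ‖a‖ ^ 2) * (1 - ‖b‖ ^ 2) :=
    mul_nonneg (by nlinarith [norm_nonneg a]) (by nlinarith [norm_nonneg b])
  linarith

theorem one_sub_ne_zero_of_norm_lt_one {c : ℂ} (hc : ‖c‖ < 1) : 1 - c ≠ 0 := by
  rintro h
  rw [← sub_eq_zero.1 h] at hc
  simp at hc

theorem norm_conj_mul_lt_one {a b : ℂ} (ha : ‖a‖ ≤ 1) (hb : ‖b‖ < 1) : ‖conj b * a‖ < 1 := by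
  rw [norm_mul, RCLike.norm_conj]
  nlinarith [norm_nonneg a, norm_nonneg b]

/-- Shrinking the disc does not increase the pseudo-hyperbolic distance. -/
theorem norm_smul_sub_smul_le {a b : ℂ} {r t : ℝ} (hr : 0 ≤ r) (ht0 : 0 ≤ t) (ht1 : t ≤ 1)
    (ha : ‖a‖ ≤ 1) (hb : ‖b‖ ≤ 1) (h : ‖a - b‖ ≤ r * ‖1 - conj b * a‖) :
    ‖(t : ℂ) * a - t * b‖ ≤ r * ‖1 - conj ((t : ℂ) * b) * (t * a)‖ := by
  have hc : ‖conj b * a‖ ≤ 1 := by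
    rw [norm_mul, RCLike.norm_conj]; exact mul_le_one₀ hb (norm_nonneg _) ha
  have key : t * ‖1 - conj b * a‖ ≤ ‖1 - conj ((t : ℂ) * b) * (t * a)‖ := by
    have e : conj ((t : ℂ) * b) * (t * a) = ((t ^ 2 : ℝ) : ℂ) * (conj b * a) := by
      simp only [map_mul, Complex.conj_ofReal]; push_cast; ring
    rw [e]
    generalize conj b * a = c at hc
    refine le_of_sq_le_sq ?_ (norm_nonneg _)
    have hc2 : ‖c‖ ^ 2 ≤ 1 := by nlinarith [norm_nonneg c]
    rw [mul_pow]
    simp only [Complex.sq_norm, Complex.normSq_apply, Complex.sub_re, Complex.sub_im,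
      Complex.re_ofReal_mul, Complex.im_ofReal_mul, Complex.one_re, Complex.one_im] at hc2 ⊢
    have ht2 : t ^ 2 ≤ 1 := by nlinarith
    -- This product equals `‖1 - t² c‖² - t² ‖1 - c‖²`.
    have : 0 ≤ (1 - t ^ 2) * (1 - t ^ 2 * (c.re * c.re + c.im * c.im)) :=
      mul_nonneg (by linarith) (by nlinarith [sq_nonneg t])
    nlinarith
  calc ‖(t : ℂ) * a - t * b‖ = t * ‖a - b‖ := by
        rw [← mul_sub, norm_mul, Complex.norm_of_nonneg ht0]
    _ ≤ t * (r * ‖1 - conj b * a‖) := by gcongr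
    _ = r * (t * ‖1 - conj b * a‖) := by ring
    _ ≤ _ := by gcongr

/-- Stands in for the triangle inequality of the pseudo-hyperbolic distance. The identity above
gives `(1 - r²) ‖1 - conj b * a‖² ≤ (1 - ‖a‖²)(1 - ‖b‖²) ≤ 1 - ‖a‖²`, and `‖1 - conj b * a‖ ≥ 1 -
s`. -/
theorem norm_sq_le_of_norm_sub_le {a b : ℂ} {r s : ℝ} (hr0 : 0 ≤ r) (hr : r < 1) (hs : s < 1)
    (ha : ‖a‖ ≤ 1) (hb : ‖b‖ ≤ s) (h : ‖a - b‖ ≤ r * ‖1 - conj b * a‖) :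
    ‖a‖ ^ 2 ≤ 1 - (1 - r ^ 2) * (1 - s) ^ 2 := by
  have hid := norm_one_sub_conj_mul_sq_sub a b
  have hlow : 1 - s ≤ ‖1 - conj b * a‖ := by
    have h1 : ‖conj b * a‖ ≤ s := by
      rw [norm_mul, RCLike.norm_conj]; nlinarith [norm_nonneg a, norm_nonneg b]
    have h2 := norm_sub_norm_le (1 : ℂ) (conj b * a)
    rw [norm_one] at h2
    linarith
  have hsq : ‖a - b‖ ^ 2 ≤ r ^ 2 * ‖1 - conj b * a‖ ^ 2 := by
    rw [← mul_pow]; gcongr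
  have hlow2 : (1 - s) ^ 2 ≤ ‖1 - conj b * a‖ ^ 2 := by
    gcongr
  have hr2 : 0 ≤ 1 - r ^ 2 := by nlinarith
  have ha2 : 0 ≤ 1 - ‖a‖ ^ 2 := by nlinarith [norm_nonneg a]
  have h3 : (1 - r ^ 2) * (1 - s) ^ 2 ≤ (1 - r ^ 2) * ‖1 - conj b * a‖ ^ 2 := by gcongr
  nlinarith [mul_nonneg ha2 (sq_nonneg ‖b‖)]

/-- The Schwarz-Pick inequality between `0` and another point of the disc. -/
theorem schwarz_pick_zero {h : ℂ → ℂ} (hd : DifferentiableOn ℂ h (ball 0 1))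
    (hb : ∀ x ∈ ball (0 : ℂ) 1, ‖h x‖ ≤ 1) {x : ℂ} (hx : x ∈ ball (0 : ℂ) 1) :
    ‖h x - h 0‖ ≤ ‖x‖ * ‖1 - conj (h 0) * h x‖ := by
  -- `h` may take values on the unit circle, where the Möbius denominator can vanish; `t * h` does
  -- not, and `t → 1` at the end.
  have strict : ∀ t : ℝ, 0 < t → t < 1 →
      ‖t * h x - t * h 0‖ ≤ ‖x‖ * ‖1 - conj (t * h 0) * (t * h x)‖ := by
    intro t ht0 ht1
    have hlt : ∀ y ∈ ball (0 : ℂ) 1, ‖t * h y‖ < 1 := fun y hy => by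
      rw [norm_mul, Complex.norm_of_nonneg ht0.le]
      nlinarith [hb y hy, norm_nonneg (h y)]
    have h0 : (0 : ℂ) ∈ ball (0 : ℂ) 1 := mem_ball_self one_pos
    have hne : ∀ y ∈ ball (0 : ℂ) 1, 1 - conj (t * h 0) * (t * h y) ≠ 0 := fun y hy =>
      one_sub_ne_zero_of_norm_lt_one (norm_conj_mul_lt_one (hlt y hy).le (hlt 0 h0))
    set u : ℂ → ℂ := fun y => (t * h y - t * h 0) / (1 - conj (t * h 0) * (t * h y)) with hu
    have hud : DifferentiableOn ℂ u (ball 0 1) :=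
      ((hd.const_mul _).sub_const _).div (((hd.const_mul _).const_mul _).const_sub _) hne
    have hmaps : Set.MapsTo u (ball 0 1) (closedBall 0 1) := fun y hy => by
      rw [mem_closedBall_zero_iff, hu, norm_div]
      exact div_le_one_of_le₀ (norm_sub_le_norm_one_sub_conj_mul (hlt y hy).le (hlt 0 h0).le)
        (norm_nonneg _)
    have := Complex.norm_le_norm_of_mapsTo_ball hud hmaps (by simp [hu]) (mem_ball_zero_iff.1 hx)
    rwa [hu, norm_div, div_le_iff₀ (norm_pos_iff.2 (hne x hx))] at this
  have c1 : Continuous fun t : ℝ => ‖t * h x - t * h 0‖ := by fun_prop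
  have c2 : Continuous fun t : ℝ => ‖x‖ * ‖1 - conj (t * h 0) * (t * h x)‖ := by
    fun_prop
  have l1 := (c1.tendsto 1).mono_left (nhdsWithin_le_nhds (s := Set.Iio 1))
  have l2 := (c2.tendsto 1).mono_left (nhdsWithin_le_nhds (s := Set.Iio 1))
  have := le_of_tendsto_of_tendsto l1 l2 (by
    filter_upwards [Ioo_mem_nhdsLT (zero_lt_one' ℝ)] with t ht using strict t ht.1 ht.2)
  simpa using this

end PseudoHyperbolicDisc

/-! ### The canonical extension of one-variable functions of a functional -/

section CanonicalExtension

variable {X : Type*} [NormedAddCommGroup X] [NormedSpace ℂ X]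

/-- The `k`-linear form `(x₁, …, x_k) ↦ φ(x₁) ⋯ φ(x_k)`. -/
def dualPow (φ : StrongDual ℂ X) (k : ℕ) : X [×k]→L[ℂ] ℂ :=
  (ContinuousMultilinearMap.mkPiAlgebra ℂ (Fin k) ℂ).compContinuousLinearMap fun _ => φ

theorem dualPow_apply (φ : StrongDual ℂ X) (k : ℕ) (m : Fin k → X) :
    dualPow φ k m = ∏ i, φ (m i) := by
  simp [dualPow]

theorem aronBerner_dualPow (z : StrongDual ℂ (StrongDual ℂ X)) (φ : StrongDual ℂ X) (k : ℕ) :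
    aronBerner z k (dualPow φ k) = z φ ^ k := by
  induction k with
  | zero => simp [aronBerner, dualPow_apply]
  | succ k ih =>
    have h : ((aronBerner z k).comp ((continuousMultilinearCurryLeftEquiv ℂ
        (fun _ : Fin (k + 1) => X) ℂ) (dualPow φ (k + 1)))) = (z φ ^ k) • φ := by
      ext x
      have : (continuousMultilinearCurryLeftEquiv ℂ (fun _ : Fin (k + 1) => X) ℂ)
          (dualPow φ (k + 1)) x = φ x • dualPow φ k := by
        ext m
        simp [dualPow_apply, Fin.prod_univ_succ]
      rw [ContinuousLinearMap.comp_apply, this, map_smul, ih]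
      simp [mul_comm]
    change z ((aronBerner z k).comp ((continuousMultilinearCurryLeftEquiv ℂ
        (fun _ : Fin (k + 1) => X) ℂ) (dualPow φ (k + 1)))) = _
    rw [h, map_smul, smul_eq_mul, pow_succ]

theorem iteratedFDeriv_comp_dual {G : ℂ → ℂ} {r : ℝ} (hr : 0 < r)
    (hG : DifferentiableOn ℂ G (ball 0 r)) (φ : StrongDual ℂ X) (k : ℕ) :
    iteratedFDeriv ℂ k (G ∘ φ) 0 = iteratedDeriv k G 0 • dualPow φ k := by
  have hc : ContDiffOn ℂ k G (ball 0 r) := hG.contDiffOn isOpen_ball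
  have hp : IsOpen (φ ⁻¹' ball (0 : ℂ) r) := isOpen_ball.preimage φ.continuous
  have h0 : φ 0 ∈ ball (0 : ℂ) r := by simpa using hr
  have := φ.iteratedFDerivWithin_comp_right hc isOpen_ball.uniqueDiffOn hp.uniqueDiffOn
    (x := 0) h0 le_rfl
  rw [iteratedFDerivWithin_of_isOpen k hp h0, iteratedFDerivWithin_of_isOpen k isOpen_ball h0]
    at this
  rw [this, map_zero]
  ext m
  simp [dualPow_apply, iteratedFDeriv_apply_eq_iteratedDeriv_mul_prod, mul_comm]

/-- The Taylor polynomials of `G ∘ φ` are multiples of powers of `φ`, which extend to powers of `z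
φ`, so the defining series becomes the Taylor series of `G` at `z φ`. -/
theorem canonicalExtension_comp_dual {f : ball (0 : X) 1 → ℂ} {G : ℂ → ℂ} {r : ℝ}
    (hG : DifferentiableOn ℂ G (ball 0 r)) {φ : StrongDual ℂ X} (hf : ∀ x, f x = G (φ x))
    {z : StrongDual ℂ (StrongDual ℂ X)} (hz : ‖z φ‖ < r) :
    canonicalExtension f z = G (z φ) := by
  have hr : 0 < r := (norm_nonneg _).trans_lt hz
  have hloc : extendZero f =ᶠ[𝓝 0] G ∘ φ := by
    filter_upwards [ball_mem_nhds (0 : X) one_pos] with x hx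
    exact (extendZero_coe f ⟨x, hx⟩).trans (hf ⟨x, hx⟩)
  rw [← Complex.taylorSeries_eq_on_ball' (mem_ball_zero_iff.2 hz) hG]
  refine tsum_congr fun k => ?_
  rw [(hloc.iteratedFDeriv ℂ k).eq_of_nhds, iteratedFDeriv_comp_dual hr hG, map_smul,
    aronBerner_dualPow, sub_zero, smul_eq_mul, mul_assoc]

/-- Since `r > 1`, the map `y ↦ G (y φ)` is continuous even at points of norm one, so it gives the
extension by continuity there. -/
theorem evalAu_comp_dual {f : Au X} {G : ℂ → ℂ} {r : ℝ} (hr : 1 < r)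
    (hG : DifferentiableOn ℂ G (ball 0 r)) {φ : StrongDual ℂ X} (hφ : ‖φ‖ ≤ 1)
    (hf : ∀ x, (f : ball (0 : X) 1 →ᵇ ℂ) x = G (φ x))
    {z : StrongDual ℂ (StrongDual ℂ X)} (hz : ‖z‖ ≤ 1) :
    evalAu z f = G (z φ) := by
  have hlt : ∀ y : StrongDual ℂ (StrongDual ℂ X), ‖y‖ ≤ 1 → ‖y φ‖ < r := fun y hy =>
    ((y.le_opNorm φ).trans (mul_le_one₀ hy (norm_nonneg _) hφ)).trans_lt hr
  refine extendFrom_eq ?_ ?_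
  · have hcl : closure (ball (0 : StrongDual ℂ (StrongDual ℂ X)) 1) = closedBall 0 1 :=
      closure_ball (E := StrongDual ℂ (StrongDual ℂ X)) 0 one_ne_zero
    exact hcl.symm ▸ (mem_closedBall_zero_iff (a := z)).2 hz
  · have hcont : ContinuousAt (fun y : StrongDual ℂ (StrongDual ℂ X) => G (y φ)) z := by
      have h1 : ContinuousAt G (z φ) :=
        (hG.differentiableAt (isOpen_ball.mem_nhds (mem_ball_zero_iff.2 (hlt z hz)))).continuousAt
      exact ContinuousAt.comp (f := fun y : StrongDual ℂ (StrongDual ℂ X) => y φ) h1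
        (ContinuousLinearMap.apply ℂ ℂ φ).continuous.continuousAt
    refine (hcont.tendsto.mono_left nhdsWithin_le_nhds).congr' ?_
    filter_upwards [self_mem_nhdsWithin] with y hy
    exact (canonicalExtension_comp_dual hG hf (hlt y ((mem_ball_zero_iff (a := y)).1 hy).le)).symm

/-- A function holomorphic near the closed disc, composed with a functional of norm at most one,
belongs to `A_u`. -/
theorem exists_Au_comp_dual {G : ℂ → ℂ} {r : ℝ} (hr : 1 < r)
    (hG : DifferentiableOn ℂ G (ball 0 r)) (hG1 : ∀ x ∈ closedBall (0 : ℂ) 1, ‖G x‖ ≤ 1)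
    {φ : StrongDual ℂ X} (hφ : ‖φ‖ ≤ 1) :
    ∃ f : Au X, ‖f‖ ≤ 1 ∧ ∀ x, (f : ball (0 : X) 1 →ᵇ ℂ) x = G (φ x) := by
  have hmem : ∀ x ∈ ball (0 : X) 1, φ x ∈ closedBall (0 : ℂ) 1 := fun x hx =>
    mem_closedBall_zero_iff.2 <| (φ.le_opNorm x).trans
      (mul_le_one₀ hφ (norm_nonneg _) (mem_ball_zero_iff.1 hx).le)
  have hsub : closedBall (0 : ℂ) 1 ⊆ ball 0 r := closedBall_subset_ball hr
  have huc : UniformContinuousOn G (closedBall 0 1) :=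
    (isCompact_closedBall (0 : ℂ) 1).uniformContinuousOn_of_continuous (hG.continuousOn.mono hsub)
  have hu : UniformContinuous fun x : ball (0 : X) 1 => G (φ x) := by
    have h1 := uniformContinuousOn_iff_restrict.1 huc
    have h2 : UniformContinuous fun x : ball (0 : X) 1 =>
        (⟨φ x, hmem x x.2⟩ : closedBall (0 : ℂ) 1) :=
      (φ.uniformContinuous.comp uniformContinuous_subtype_val).subtype_mk _
    exact h1.comp h2
  have hb : ∀ x : ball (0 : X) 1, ‖G (φ x)‖ ≤ 1 := fun x => hG1 _ (hmem x x.2)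
  set f : ball (0 : X) 1 →ᵇ ℂ :=
    BoundedContinuousFunction.ofNormedAddCommGroup (fun x => G (φ x)) hu.continuous 1 hb with hf
  have hhol : f ∈ HInf X := isHolomorphic_of_eq
    (hG.comp φ.differentiable.differentiableOn fun x hx => hsub (hmem x hx)) fun _ => rfl
  exact ⟨⟨f, hhol, hu⟩, (BoundedContinuousFunction.norm_le zero_le_one).2 hb, fun _ => rfl⟩

theorem norm_comp_dual_le {z w : StrongDual ℂ (StrongDual ℂ X)} (hz : ‖z‖ ≤ 1) (hw : ‖w‖ ≤ 1)
    {G : ℂ → ℂ} {r : ℝ} (hr : 1 < r)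
    (hG : DifferentiableOn ℂ G (ball 0 r)) (hG1 : ∀ x ∈ closedBall (0 : ℂ) 1, ‖G x‖ ≤ 1)
    {φ : StrongDual ℂ X} (hφ : ‖φ‖ ≤ 1) (h0 : G (w φ) = 0) :
    ‖G (z φ)‖ₑ ≤ pseudoHyperbolic (evalAu z) (evalAu w) := by
  obtain ⟨f, hf1, hf⟩ := exists_Au_comp_dual hr hG hG1 hφ
  rw [← evalAu_comp_dual hr hG hφ hf hz]
  rw [← evalAu_comp_dual hr hG hφ hf hw] at h0
  exact le_iSup₂_of_le f hf1 (le_iSup_of_le h0 le_rfl)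

end CanonicalExtension

/-! ### Möbius test functions and their boundary substitutes -/

section TestFunctions

theorem exists_one_lt_forall_one_sub_mul_ne_zero {c : ℂ} (hc : ‖c‖ < 1) :
    ∃ r : ℝ, 1 < r ∧ ∀ x ∈ ball (0 : ℂ) r, 1 - c * x ≠ 0 := by
  have h0 := norm_nonneg c
  -- A radius above `1` and below `1 / ‖c‖` that also works for `c = 0`.
  refine ⟨2 / (1 + ‖c‖), by rw [lt_div_iff₀ (by positivity)]; linarith, fun x hx => ?_⟩
  refine one_sub_ne_zero_of_norm_lt_one ?_
  rw [mem_ball_zero_iff, lt_div_iff₀ (by positivity)] at hx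
  rw [norm_mul]
  nlinarith [norm_nonneg x]

/-- For a zero `b` on the unit circle the Möbius map degenerates to a constant. The substitute is
`(1 + t) / 2 * (x - b) / (1 - t * conj b * x)`, with pole off the closed disc for `t < 1`; the
factor `(1 + t) / 2` is sharp at `x = -b`. -/
theorem norm_peak_le {b x : ℂ} (hb : ‖b‖ = 1) (hx : ‖x‖ ≤ 1) {t : ℝ} (ht0 : 0 ≤ t) (ht1 : t ≤ 1) :
    (1 + t) / 2 * ‖x - b‖ ≤ ‖1 - t * conj b * x‖ := by
  have hc : ‖conj b * x‖ ≤ 1 := by rw [norm_mul, RCLike.norm_conj, hb, one_mul]; exact hx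
  have e : ‖x - b‖ = ‖1 - conj b * x‖ := by
    have hbb : conj b * b = 1 := by rw [Complex.conj_mul', hb]; norm_num
    calc ‖x - b‖ = ‖conj b * (x - b)‖ := by rw [norm_mul, RCLike.norm_conj, hb, one_mul]
      _ = ‖1 - conj b * x‖ := by rw [mul_sub, hbb, norm_sub_rev]
  rw [e, mul_assoc]
  generalize conj b * x = c at hc
  refine le_of_sq_le_sq ?_ (norm_nonneg _)
  have hre : -1 ≤ c.re := (abs_le.1 ((Complex.abs_re_le_norm c).trans hc)).1
  have hc2 : ‖c‖ ^ 2 ≤ 1 := by nlinarith [norm_nonneg c]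
  rw [mul_pow]
  simp only [Complex.sq_norm, Complex.normSq_apply, Complex.sub_re, Complex.sub_im,
    Complex.re_ofReal_mul, Complex.im_ofReal_mul, Complex.one_re, Complex.one_im] at hc2 ⊢
  have : 0 ≤ (1 - t) * (3 + t + 2 * c.re * (1 - t) - (c.re * c.re + c.im * c.im) * (3 * t + 1)) :=
    mul_nonneg (by linarith) (by nlinarith)
  nlinarith

variable {X : Type*} [NormedAddCommGroup X] [NormedSpace ℂ X]

/-- Functionals of norm at most one contract the pseudo-hyperbolic distance. -/
theorem norm_apply_sub_apply_le {z w : StrongDual ℂ (StrongDual ℂ X)} (hz : ∀ η, ‖z η‖ ≤ ‖η‖)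
    (hw : ∀ η, ‖w η‖ ≤ ‖η‖) {φ : StrongDual ℂ X} (hφ : ‖φ‖ ≤ 1)
    {r : ℝ} (hr : 0 ≤ r) (h : pseudoHyperbolic (evalAu z) (evalAu w) ≤ ENNReal.ofReal r) :
    ‖z φ - w φ‖ ≤ r * ‖1 - conj (w φ) * z φ‖ := by
  have hz1 : ‖z‖ ≤ 1 := z.opNorm_le_bound zero_le_one fun η => by simpa using hz η
  have hw1 : ‖w‖ ≤ 1 := w.opNorm_le_bound zero_le_one fun η => by simpa using hw η
  have test : ∀ α c : ℂ, ‖c‖ < 1 →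
      (∀ x : ℂ, ‖x‖ ≤ 1 → ‖α * (x - w φ)‖ ≤ ‖1 - c * x‖) →
      ‖α * (z φ - w φ)‖ ≤ r * ‖1 - c * z φ‖ := by
    intro α c hc hα
    obtain ⟨R, hR, hne⟩ := exists_one_lt_forall_one_sub_mul_ne_zero hc
    have hd : DifferentiableOn ℂ (fun x => α * (x - w φ) / (1 - c * x)) (ball 0 R) :=
      ((differentiableOn_id.sub_const _).const_mul _).div
        ((differentiableOn_id.const_mul _).const_sub _) hne
    have hle := (norm_comp_dual_le hz1 hw1 hR hd (fun x hx => by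
      rw [norm_div]
      exact div_le_one_of_le₀ (hα x (mem_closedBall_zero_iff.1 hx)) (norm_nonneg _)) hφ
      (by simp)).trans h
    rw [← ofReal_norm, ENNReal.ofReal_le_ofReal_iff hr, norm_div, div_le_iff₀] at hle
    · exact hle
    · exact norm_pos_iff.2 (hne _ (mem_ball_zero_iff.2 (((hz φ).trans hφ).trans_lt hR)))
  rcases ((hw φ).trans hφ).lt_or_eq with hlt | heq
  · simpa using test 1 (conj (w φ)) (by rwa [RCLike.norm_conj]) fun x hx => by
      simpa using norm_sub_le_norm_one_sub_conj_mul hx hlt.le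
  -- Here `‖w φ‖ = 1`: the bounds from the substitute functions pass to the limit `t → 1`.
  · have c1 : Continuous fun t : ℝ => (1 + t) / 2 * ‖z φ - w φ‖ := by fun_prop
    have c2 : Continuous fun t : ℝ => r * ‖1 - t * conj (w φ) * z φ‖ := by fun_prop
    have l1 := (c1.tendsto 1).mono_left (nhdsWithin_le_nhds (s := Set.Iio 1))
    have l2 := (c2.tendsto 1).mono_left (nhdsWithin_le_nhds (s := Set.Iio 1))
    have := le_of_tendsto_of_tendsto l1 l2 (by
      filter_upwards [Ioo_mem_nhdsLT (zero_lt_one' ℝ)] with t ht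
      have hn : ∀ x : ℂ, ‖(((1 + t) / 2 : ℝ) : ℂ) * x‖ = (1 + t) / 2 * ‖x‖ := fun x => by
        rw [norm_mul, Complex.norm_of_nonneg (by linarith [ht.1])]
      rw [← hn]
      refine test _ _ ?_ fun x hx => ?_
      · rw [norm_mul, RCLike.norm_conj, heq, Complex.norm_of_nonneg ht.1.le]
        linarith [ht.2]
      · rw [hn]
        exact norm_peak_le heq hx ht.1.le ht.2.le)
    simpa using this

end TestFunctions

/-! ### Coordinates, truncations and analytic discs in the ball of `c₀` -/

section Coordinates

/-- The `n`-th coordinate functional on `c₀`. -/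
def coord (n : ℕ) : StrongDual ℂ C₀(ℕ, ℂ) :=
  LinearMap.mkContinuous { toFun := fun x => x n, map_add' := fun _ _ => rfl,
                           map_smul' := fun _ _ => rfl } 1 fun x => by
    rw [one_mul, ← ZeroAtInftyContinuousMap.norm_toBCF_eq_norm]
    exact x.toBCF.norm_coe_le_norm n

theorem norm_coord_le (n : ℕ) : ‖coord n‖ ≤ 1 :=
  LinearMap.mkContinuous_norm_le _ zero_le_one _

theorem toBidual_coord (z : lp (fun _ : ℕ => ℂ) ∞) (n : ℕ) : toBidual z (coord n) = z n := by
  change ∑' m, (Pi.single m (1 : ℂ) : ℕ → ℂ) n * z m = z n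
  rw [tsum_eq_single n fun m hm => by simp [hm.symm]]
  simp

theorem norm_toBidual_apply_le {z : lp (fun _ : ℕ => ℂ) ∞} (hz : ‖z‖ ≤ 1)
    (φ : StrongDual ℂ C₀(ℕ, ℂ)) : ‖toBidual z φ‖ ≤ ‖φ‖ := by
  refine (tsum_of_norm_bounded (summable_norm_apply_unitVec φ).hasSum fun n =>
    (norm_apply_unitVec_mul_le φ z n).trans (mul_le_of_le_one_right (norm_nonneg _) hz)).trans ?_
  exact Real.tsum_le_of_sum_le (fun _ => norm_nonneg _) (sum_norm_apply_unitVec_le φ)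

/-- The vector of `c₀` whose first `k` coordinates are those of `s` and whose other coordinates
vanish. -/
def truncation (s : ℕ → ℂ) (k : ℕ) : C₀(ℕ, ℂ) :=
  ∑ n ∈ Finset.range k, s n • unitVec n

theorem truncation_apply (s : ℕ → ℂ) (k m : ℕ) :
    truncation s k m = if m < k then s m else 0 := by
  change coord m (truncation s k) = _
  have h : ∀ n, coord m (unitVec n) = (Pi.single n (1 : ℂ) : ℕ → ℂ) m := fun _ => rfl
  simp [truncation, h, Pi.single_apply]

/-- Strictness survives because the supremum runs over finitely many coordinates. -/
theorem norm_truncation_lt_one {s : ℕ → ℂ} (hs : ∀ n, ‖s n‖ < 1) (k : ℕ) :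
    ‖truncation s k‖ < 1 := by
  have hlt : (Finset.range k).sup (fun n => ‖s n‖₊) < 1 :=
    (Finset.sup_lt_iff (by simp)).2 fun n _ => hs n
  refine lt_of_le_of_lt ?_ (NNReal.coe_lt_coe.2 hlt)
  rw [← ZeroAtInftyContinuousMap.norm_toBCF_eq_norm]
  refine (BoundedContinuousFunction.norm_le (NNReal.coe_nonneg _)).2 fun m => ?_
  change ‖truncation s k m‖ ≤ _
  rw [truncation_apply]
  split_ifs with hm
  · exact NNReal.coe_le_coe.2 (Finset.le_sup (f := fun n => ‖s n‖₊) (Finset.mem_range.2 hm))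
  · simp

/-- The Schwarz-Pick inequality on the unit ball of `c₀`, for finitely supported points. -/
theorem schwarz_pick_truncation {F : C₀(ℕ, ℂ) → ℂ} (hF : DifferentiableOn ℂ F (ball 0 1))
    (hF1 : ∀ x ∈ ball (0 : C₀(ℕ, ℂ)) 1, ‖F x‖ ≤ 1) {a b : ℕ → ℂ} (ha : ∀ n, ‖a n‖ < 1)
    (hb : ∀ n, ‖b n‖ < 1) {r : ℝ} (hr0 : 0 < r) (hr1 : r < 1)
    (hab : ∀ n, ‖a n - b n‖ ≤ r * ‖1 - conj (b n) * a n‖) (k : ℕ) :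
    ‖F (truncation a k) - F (truncation b k)‖ ≤
      r * ‖1 - conj (F (truncation b k)) * F (truncation a k)‖ := by
  have hne : ∀ n, 1 - conj (b n) * a n ≠ 0 := fun n =>
    one_sub_ne_zero_of_norm_lt_one (norm_conj_mul_lt_one (ha n).le (hb n))
  -- The Möbius image of `a n`, divided by `r`; `hab` says exactly that it stays in the closed disc.
  set c : ℕ → ℂ := fun n => (a n - b n) / (r * (1 - conj (b n) * a n)) with hc
  have hr' : (r : ℂ) ≠ 0 := by exact_mod_cast hr0.ne'
  have hc1 : ∀ n, ‖c n‖ ≤ 1 := fun n => by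
    rw [hc, norm_div, norm_mul, Complex.norm_of_nonneg hr0.le]
    exact div_le_one_of_le₀ (hab n) (by positivity)
  have hcl : ∀ n, ∀ x ∈ ball (0 : ℂ) 1, ‖x * c n‖ < 1 := fun n x hx => by
    rw [mem_ball_zero_iff] at hx
    rw [norm_mul]
    nlinarith [hc1 n, norm_nonneg (c n), norm_nonneg x]
  have hden : ∀ n, ∀ x ∈ ball (0 : ℂ) 1, 1 + conj (b n) * (x * c n) ≠ 0 := fun n x hx => by
    have := one_sub_ne_zero_of_norm_lt_one
      (norm_conj_mul_lt_one (b := -b n) (hcl n x hx).le (by simpa using hb n))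
    simpa using this
  -- The inverse Möbius maps form an analytic disc with `s 0 = b` and `s r = a`, so the one-variable
  -- Schwarz-Pick inequality between `0` and `r` applies.
  set s : ℂ → ℕ → ℂ := fun x n => (x * c n + b n) / (1 + conj (b n) * (x * c n)) with hs
  have hs1 : ∀ x ∈ ball (0 : ℂ) 1, ∀ n, ‖s x n‖ < 1 := fun x hx n => by
    rw [hs, norm_div, div_lt_one (norm_pos_iff.2 (hden n x hx))]
    refine lt_of_pow_lt_pow_left₀ 2 (norm_nonneg _) ?_
    have h1 := norm_one_sub_conj_mul_sq_sub (x * c n) (-b n)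
    have h2 : 0 < (1 - ‖x * c n‖ ^ 2) * (1 - ‖-b n‖ ^ 2) := by
      rw [norm_neg]
      exact mul_pos (by nlinarith [hcl n x hx, norm_nonneg (x * c n)])
        (by nlinarith [hb n, norm_nonneg (b n)])
    have h3 : ‖1 - conj (-b n) * (x * c n)‖ = ‖1 + conj (b n) * (x * c n)‖ := by
      congr 1; simp
    rw [h3, sub_neg_eq_add] at h1
    linarith
  have hmem : ∀ x ∈ ball (0 : ℂ) 1, truncation (s x) k ∈ ball (0 : C₀(ℕ, ℂ)) 1 := fun x hx =>
    mem_ball_zero_iff.2 (norm_truncation_lt_one (hs1 x hx) k)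
  have hd : DifferentiableOn ℂ (fun x => truncation (s x) k) (ball 0 1) := by
    refine DifferentiableOn.fun_sum fun n _ => DifferentiableOn.smul_const ?_ _
    exact ((differentiableOn_id.mul_const _).add_const _).div
      (((differentiableOn_id.mul_const _).const_mul _).const_add _) (hden n)
  have h0 : s 0 = b := by ext n; simp [hs]
  have hr : s r = a := by
    ext n
    have hrc : (r : ℂ) * c n = (a n - b n) / (1 - conj (b n) * a n) := by
      rw [hc]; field_simp
    have hbb : 1 - conj (b n) * b n ≠ 0 :=
      one_sub_ne_zero_of_norm_lt_one (norm_conj_mul_lt_one (hb n).le (hb n))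
    have e1 : (a n - b n) / (1 - conj (b n) * a n) + b n
        = a n * (1 - conj (b n) * b n) / (1 - conj (b n) * a n) := by
      rw [div_add' _ _ _ (hne n)]; congr 1; ring
    have e2 : 1 + conj (b n) * ((a n - b n) / (1 - conj (b n) * a n))
        = (1 - conj (b n) * b n) / (1 - conj (b n) * a n) := by
      rw [mul_div_assoc', add_div' _ _ _ (hne n)]; congr 1; ring
    simp only [hs]
    rw [hrc, e1, e2, div_div_div_cancel_right₀ (hne n), mul_div_cancel_right₀ _ hbb]
  have hrm : (r : ℂ) ∈ ball (0 : ℂ) 1 := by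
    rw [mem_ball_zero_iff, Complex.norm_of_nonneg hr0.le]; exact hr1
  have := schwarz_pick_zero (h := fun x => F (truncation (s x) k)) (hF.comp hd hmem)
    (fun x hx => hF1 _ (hmem x hx)) hrm
  rwa [h0, hr, Complex.norm_of_nonneg hr0.le] at this

end Coordinates

/-! ### Limit characters and equality of Gleason parts -/

section Characters

/-- Point evaluations of `H^∞` along an ultrafilter converge to a character. -/
theorem exists_spectrum_tendsto {X : Type*} [NormedAddCommGroup X] [NormedSpace ℂ X]
    {ι : Type*} (U : Ultrafilter ι) (x : ι → ball (0 : X) 1) :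
    ∃ χ : Spectrum (HInf X), ∀ f : HInf X,
      Tendsto (fun k => (f : ball (0 : X) 1 →ᵇ ℂ) (x k)) U (𝓝 (χ f)) := by
  have hlim : ∀ f : HInf X, ∃ l : ℂ, ‖l‖ ≤ ‖f‖ ∧
      Tendsto (fun k => (f : ball (0 : X) 1 →ᵇ ℂ) (x k)) U (𝓝 l) := fun f => by
    obtain ⟨l, hl, hle⟩ := (isCompact_closedBall (0 : ℂ) ‖f‖).ultrafilter_le_nhds
      (U.map fun k => (f : ball (0 : X) 1 →ᵇ ℂ) (x k)) (by
        rw [le_principal_iff]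
        exact Eventually.of_forall (f := (U : Filter ι)) fun k =>
          mem_closedBall_zero_iff.2 ((f : ball (0 : X) 1 →ᵇ ℂ).norm_coe_le_norm (x k)))
    exact ⟨l, mem_closedBall_zero_iff.1 hl, hle⟩
  choose L hL hT using hlim
  have hadd : ∀ f g, L (f + g) = L f + L g := fun f g =>
    tendsto_nhds_unique (hT (f + g)) ((hT f).add (hT g))
  have hmul : ∀ f g, L (f * g) = L f * L g := fun f g =>
    tendsto_nhds_unique (hT (f * g)) ((hT f).mul (hT g))
  have hsmul : ∀ (c : ℂ) f, L (c • f) = c * L f := fun c f =>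
    tendsto_nhds_unique (hT (c • f)) ((hT f).const_mul c)
  have hone : L 1 = 1 := tendsto_nhds_unique (hT 1) tendsto_const_nhds
  set Λ : HInf X →L[ℂ] ℂ := LinearMap.mkContinuous
    { toFun := L, map_add' := hadd, map_smul' := hsmul } 1 (fun f => by
      rw [one_mul]; exact hL f) with hΛ
  refine ⟨⟨StrongDual.toWeakDual Λ, fun h => ?_, hmul⟩, hT⟩
  have h1 : L 1 = 0 := DFunLike.congr_fun h 1
  rw [hone] at h1
  exact one_ne_zero h1

/-- If `f` vanishes at `χ`, then `‖φ f‖ ≤ s < 1`, and `norm_sq_le_of_norm_sub_le` bounds `‖ψ f‖`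
away from `1` uniformly in `f`. -/
theorem gleasonPart_subset {X : Type*} [NormedAddCommGroup X]
    {A : Subalgebra ℂ (ball (0 : X) 1 →ᵇ ℂ)} {φ ψ : Spectrum A} {r : ℝ}
    (hr0 : 0 ≤ r) (hr : r < 1) (hψ : ∀ f : A, ‖f‖ ≤ 1 → ‖ψ f‖ ≤ 1)
    (h : ∀ f : A, ‖f‖ ≤ 1 → ‖ψ f - φ f‖ ≤ r * ‖1 - conj (φ f) * ψ f‖) :
    gleasonPart φ ⊆ gleasonPart ψ := by
  intro χ hχ
  have hχ' : pseudoHyperbolic φ χ < 1 := hχ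
  set s : ℝ := (pseudoHyperbolic φ χ).toReal
  have hs : s < 1 := by
    simpa using (ENNReal.toReal_lt_toReal (hχ'.trans ENNReal.one_lt_top).ne ENNReal.one_ne_top).2 hχ'
  have hφs : ∀ f : A, ‖f‖ ≤ 1 → χ f = 0 → ‖φ f‖ ≤ s := fun f hf h0 => by
    have : ‖φ f‖ₑ ≤ pseudoHyperbolic φ χ := le_iSup₂_of_le f hf (le_iSup_of_le h0 le_rfl)
    simpa using ENNReal.toReal_mono (hχ'.trans ENNReal.one_lt_top).ne this
  have hq : √(1 - (1 - r ^ 2) * (1 - s) ^ 2) < 1 := by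
    rw [Real.sqrt_lt' one_pos]
    have : 0 < (1 - r ^ 2) * (1 - s) ^ 2 :=
      mul_pos (by nlinarith) (pow_pos (by linarith) 2)
    linarith
  have hle : pseudoHyperbolic ψ χ ≤ ENNReal.ofReal (√(1 - (1 - r ^ 2) * (1 - s) ^ 2)) :=
    iSup₂_le fun f hf => iSup_le fun h0 => by
      rw [← ofReal_norm]
      exact ENNReal.ofReal_le_ofReal (Real.le_sqrt_of_sq_le
        (norm_sq_le_of_norm_sub_le hr0 hr hs (hψ f hf) (hφs f hf h0) (h f hf)))
  exact hle.trans_lt (by rwa [← ENNReal.ofReal_one, ENNReal.ofReal_lt_ofReal_iff one_pos])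

theorem gleasonPart_eq {X : Type*} [NormedAddCommGroup X]
    {A : Subalgebra ℂ (ball (0 : X) 1 →ᵇ ℂ)} {φ ψ : Spectrum A} {r : ℝ}
    (hr0 : 0 ≤ r) (hr : r < 1) (hφ : ∀ f : A, ‖f‖ ≤ 1 → ‖φ f‖ ≤ 1)
    (hψ : ∀ f : A, ‖f‖ ≤ 1 → ‖ψ f‖ ≤ 1)
    (h : ∀ f : A, ‖f‖ ≤ 1 → ‖φ f - ψ f‖ ≤ r * ‖1 - conj (ψ f) * φ f‖) :
    gleasonPart φ = gleasonPart ψ := by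
  refine (gleasonPart_subset hr0 hr hψ fun f hf => ?_).antisymm (gleasonPart_subset hr0 hr hφ h)
  have e : 1 - conj (φ f) * ψ f = conj (1 - conj (ψ f) * φ f) := by simp [mul_comm]
  rw [e, RCLike.norm_conj, norm_sub_rev]
  exact h f hf

end Characters

/-! ### Weak-star approximation and the passage to the limit -/

section Approximation

/-- The truncations of `z`, scaled into the open unit ball of `c₀`. -/
def approx (z : ℕ → ℂ) (k : ℕ) : C₀(ℕ, ℂ) :=
  truncation (fun n => ((k / (k + 1) : ℝ) : ℂ) * z n) k

theorem norm_scale_mul_lt_one {a : ℂ} (ha : ‖a‖ ≤ 1) (k : ℕ) :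
    ‖((k / (k + 1) : ℝ) : ℂ) * a‖ < 1 := by
  have h1 : (k / (k + 1) : ℝ) < 1 := by rw [div_lt_one (by positivity)]; linarith
  rw [norm_mul, Complex.norm_of_nonneg (by positivity)]
  exact (mul_le_of_le_one_right (by positivity) ha).trans_lt h1

theorem approx_mem_ball {z : ℕ → ℂ} (hz : ∀ n, ‖z n‖ ≤ 1) (k : ℕ) :
    approx z k ∈ ball (0 : C₀(ℕ, ℂ)) 1 :=
  mem_ball_zero_iff.2 (norm_truncation_lt_one (fun n => norm_scale_mul_lt_one (hz n) k) k)

/-- The vectors `approx z k` converge to `z` in the weak-star topology of the bidual. -/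
theorem tendsto_apply_approx (z : lp (fun _ : ℕ => ℂ) ∞) (φ : StrongDual ℂ C₀(ℕ, ℂ)) :
    Tendsto (fun k => φ (approx z k)) atTop (𝓝 (toBidual z φ)) := by
  have h1 : Tendsto (fun k : ℕ => ((k / (k + 1) : ℝ) : ℂ)) atTop (𝓝 ((1 : ℝ) : ℂ)) :=
    (Complex.continuous_ofReal.tendsto 1).comp (tendsto_natCast_div_add_atTop 1)
  have h2 := h1.mul (summable_apply_unitVec_mul φ z).hasSum.tendsto_sum_nat
  rw [Complex.ofReal_one, one_mul] at h2
  refine h2.congr fun k => ?_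
  rw [approx, truncation, map_sum, Finset.mul_sum]
  refine Finset.sum_congr rfl fun n _ => ?_
  rw [map_smul, smul_eq_mul]
  ring

theorem exists_fiber_gleasonPart_eq (z w : lp (fun _ : ℕ => ℂ) ∞) (hz : ‖z‖ ≤ 1) (hw : ‖w‖ ≤ 1)
    (h : pseudoHyperbolic (evalAu (toBidual z)) (evalAu (toBidual w)) < 1) :
    ∃ φ ∈ fiber (toBidual z), ∃ ψ ∈ fiber (toBidual w), gleasonPart φ = gleasonPart ψ := by
  -- `r` is taken strictly positive because the analytic disc divides by it.
  obtain ⟨r, hr0, hr1, hr⟩ : ∃ r : ℝ, 0 < r ∧ r < 1 ∧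
      pseudoHyperbolic (evalAu (toBidual z)) (evalAu (toBidual w)) ≤ ENNReal.ofReal r := by
    obtain ⟨r, hr, hr1⟩ := ENNReal.lt_iff_exists_nnreal_btwn.1 h
    exact ⟨r, NNReal.coe_pos.2 (ENNReal.coe_pos.1 (pos_of_gt hr)), by exact_mod_cast hr1,
      by simpa using hr.le⟩
  have hz1 : ∀ n, ‖z n‖ ≤ 1 := fun n => (lp.norm_apply_le_norm ENNReal.top_ne_zero z n).trans hz
  have hw1 : ∀ n, ‖w n‖ ≤ 1 := fun n => (lp.norm_apply_le_norm ENNReal.top_ne_zero w n).trans hw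
  have hzw : ∀ n, ‖z n - w n‖ ≤ r * ‖1 - conj (w n) * z n‖ := fun n => by
    have := norm_apply_sub_apply_le (norm_toBidual_apply_le hz) (norm_toBidual_apply_le hw)
      (norm_coord_le n) hr0.le hr
    rwa [toBidual_coord, toBidual_coord] at this
  have hU : ((hyperfilter ℕ : Ultrafilter ℕ) : Filter ℕ) ≤ atTop := Nat.hyperfilter_le_atTop
  -- The same ultrafilter serves `φ` and `ψ`, so inequalities between values at paired approximants
  -- pass to the limit.
  obtain ⟨φ, hφ⟩ := exists_spectrum_tendsto (hyperfilter ℕ)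
    fun k => ⟨approx z k, approx_mem_ball hz1 k⟩
  obtain ⟨ψ, hψ⟩ := exists_spectrum_tendsto (hyperfilter ℕ)
    fun k => ⟨approx w k, approx_mem_ball hw1 k⟩
  refine ⟨φ, fun η => tendsto_nhds_unique (hφ _) ((tendsto_apply_approx z η).mono_left hU),
    ψ, fun η => tendsto_nhds_unique (hψ _) ((tendsto_apply_approx w η).mono_left hU),
    gleasonPart_eq hr0.le hr1
      (fun f hf => le_of_tendsto (hφ f).norm (Eventually.of_forall fun k =>
        ((f : ball (0 : C₀(ℕ, ℂ)) 1 →ᵇ ℂ).norm_coe_le_norm _).trans hf))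
      (fun f hf => le_of_tendsto (hψ f).norm (Eventually.of_forall fun k =>
        ((f : ball (0 : C₀(ℕ, ℂ)) 1 →ᵇ ℂ).norm_coe_le_norm _).trans hf))
      fun f hf => ?_⟩
  refine le_of_tendsto_of_tendsto ((hφ f).sub (hψ f)).norm
    ((tendsto_const_nhds.sub
      (((Complex.continuous_conj.tendsto _).comp (hψ f)).mul (hφ f))).norm.const_mul r)
    (Eventually.of_forall fun k => ?_)
  have key := schwarz_pick_truncation (F := extendZero (f : ball (0 : C₀(ℕ, ℂ)) 1 →ᵇ ℂ)) f.2
    (fun x hx => by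
      rw [extendZero_coe _ ⟨x, hx⟩]
      exact ((f : ball (0 : C₀(ℕ, ℂ)) 1 →ᵇ ℂ).norm_coe_le_norm _).trans hf)
    (fun n => norm_scale_mul_lt_one (hz1 n) k) (fun n => norm_scale_mul_lt_one (hw1 n) k) hr0 hr1
    (fun n => norm_smul_sub_smul_le hr0.le (by positivity)
      (div_le_one_of_le₀ (by linarith) (by positivity)) (hz1 n) (hw1 n) (hzw n)) k
  change ‖extendZero _ (approx z k) - extendZero _ (approx w k)‖ ≤
    r * ‖1 - conj (extendZero _ (approx w k)) * extendZero _ (approx z k)‖ at key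
  rw [extendZero_coe _ ⟨approx z k, approx_mem_ball hz1 k⟩,
    extendZero_coe _ ⟨approx w k, approx_mem_ball hw1 k⟩] at key
  exact key

end Approximation

end GleasonParts

end

theorem mainTheorem6 (z w : lp (fun _ : ℕ => ℂ) ∞) (hz : ‖z‖ = 1) (hw : ‖w‖ = 1)
    (h : GleasonParts.pseudoHyperbolic
      (GleasonParts.evalAu (GleasonParts.toBidual z))
      (GleasonParts.evalAu (GleasonParts.toBidual w)) < 1) :
    ∃ φ ∈ GleasonParts.fiber (GleasonParts.toBidual z),
      ∃ ψ ∈ GleasonParts.fiber (GleasonParts.toBidual w),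
        GleasonParts.gleasonPart φ = GleasonParts.gleasonPart ψ :=
  GleasonParts.exists_fiber_gleasonPart_eq z w hz.le hw.le h
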